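/- Let $\Bbbk$ be a field and $X$ a set. A Poisson algebra is a $\Bbbk$-space with a bilinear associative commutative product (an identity element is not required) and a Lie bracket $\{\cdot,\cdot\}$ such that $\{x,yz\}=\{x,y\}z+y\{x,z\}$. A differential Poisson algebra is a Poisson algebra with a linear map $d$ that is a derivation relative to both products. Let $\mathrm{PoisDer}\langle X,d\rangle$ be the free differential Poisson algebra generated by $X$. A GD-algebra is a Lie algebra $(A,[\cdot,\cdot])$ over $\Bbbk$ with a bilinear product $\circ$ such that $$(a\circ b)\circ c-a\circ(b\circ c)=(b\circ a)\circ c-b\circ(a\circ c),\qquad (a\circ b)\circ c=(a\circ c)\circ b,$$ $$[a,b\circ c]-[c,b\circ a]+[b,a]\circ c-[b,c]\circ a-b\circ[a,c]=0 .$$ Every differential Poisson algebra is a GD-algebra under $[u,v]=\{u,v\}$ and $u\circ v=u\,d(v)$. A GD-algebra is special if it embeds into a differential Poisson algebra considered as a GD-algebra in this way, and $\mathrm{SGD}$ denotes the class of all homomorphic images of special GD-algebras. A differential Poisson monomial is an expression built from elements of $X$ by means of $d$, $\{\cdot,\cdot\}$ and $\cdot$, considered as an element of $\mathrm{PoisDer}\langle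 X,d\rangle$. Its weight is defined by $\mathrm{wt}(x)=-1$ for $x\in X$, $\mathrm{wt}(d(u))=\mathrm{wt}(u)+1$, $\mathrm{wt}(\{u,v\})=\mathrm{wt}(u)+\mathrm{wt}(v)+1$, $\mathrm{wt}(uv)=\mathrm{wt}(u)+\mathrm{wt}(v)$. Theorem. Let $\mathrm{SGD}\langle X\rangle\subset\mathrm{PoisDer}\langle X,d\rangle$ be the GD-subalgebra generated by $X$ relative to $\{\cdot,\cdot\}$ and $u\circ v=u\,d(v)$. Then: (1) $\mathrm{SGD}\langle X\rangle$ is the free algebra of the class $\mathrm{SGD}$ generated by $X$: it belongs to $\mathrm{SGD}$, and every map from $X$ to an algebra $A\in\mathrm{SGD}$ extends uniquely to a homomorphism of GD-algebras $\mathrm{SGD}\langle X\rangle\to A$. (2) As a subspace of $\mathrm{PoisDer}\langle X,d\rangle$, $\mathrm{SGD}\langle X\rangle$ equals the linear span of all differential Poisson monomials of weight $-1$. -/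

import Mathlib

universe u v w w'

/-! ### Differential Poisson algebras -/

/-- A Poisson ring: an associative commutative multiplication (no identity element is required)
and a Lie bracket `⁅·,·⁆` on the same additive group, related by the Leibniz identity. -/
class PoissonRing (V : Type*) extends NonUnitalCommRing V, LieRing V where
  lie_mul' : ∀ x y z : V, ⁅x, y * z⁆ = ⁅x, y⁆ * z + y * ⁅x, z⁆

/-- A Poisson algebra over `k`: a Poisson ring whose two products are `k`-bilinear. -/
class PoissonAlgebra (k V : Type*) [Field k] [PoissonRing V] extends LieAlgebra k V where
  smul_mul' : ∀ (c : k) (x y : V), (c • x) * y = c • (x * y)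

/-- A differential Poisson algebra over `k`: a Poisson algebra with a linear map `der` that is a
derivation relative to both products. -/
class DiffPoissonAlgebra (k V : Type*) [Field k] [PoissonRing V] extends PoissonAlgebra k V where
  der : V →ₗ[k] V
  der_mul' : ∀ x y : V, der (x * y) = der x * y + x * der y
  der_lie' : ∀ x y : V, der ⁅x, y⁆ = ⁅der x, y⁆ + ⁅x, der y⁆

namespace DiffPoissonAlgebra

variable (k : Type*) {V : Type*} [Field k] [PoissonRing V] [DiffPoissonAlgebra k V]

theorem mul_smul' (c : k) (x y : V) : x * (c • y) = c • (x * y) := by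
  rw [mul_comm, PoissonAlgebra.smul_mul', mul_comm]

/-- The operation `u ∘ v = u d(v)` as a bilinear map. -/
def circ : V →ₗ[k] V →ₗ[k] V :=
  LinearMap.mk₂ k (fun u v => u * der (k := k) v)
    (fun _ _ _ => add_mul _ _ _)
    (fun _ _ _ => PoissonAlgebra.smul_mul' _ _ _)
    (fun _ _ _ => by rw [map_add, mul_add])
    (fun _ _ _ => by rw [map_smul, mul_smul'])

theorem circ_apply (u v : V) : circ k u v = u * der (k := k) v := rfl

end DiffPoissonAlgebra

/-! ### GD-algebras -/

/-- A Gelfand-Dorfman algebra over `k`: a Lie algebra with a bilinear Novikov product `circ`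
(left-symmetric and right-commutative), satisfying the compatibility identity
`[a, b∘c] - [c, b∘a] + [b, a]∘c - [b, c]∘a - b∘[a, c] = 0`. -/
class GDAlgebra (k A : Type*) [Field k] [LieRing A] extends LieAlgebra k A where
  circ : A →ₗ[k] A →ₗ[k] A
  left_symm : ∀ a b c : A,
    circ (circ a b) c - circ a (circ b c) = circ (circ b a) c - circ b (circ a c)
  right_comm : ∀ a b c : A, circ (circ a b) c = circ (circ a c) b
  compat : ∀ a b c : A,
    ⁅a, circ b c⁆ - ⁅c, circ b a⁆ + circ ⁅b, a⁆ c - circ ⁅b, c⁆ a - circ b ⁅a, c⁆ = 0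

/-- Every differential Poisson algebra is a GD-algebra with its Lie bracket and
`u ∘ v = u d(v)`. -/
instance DiffPoissonAlgebra.toGDAlgebra (k V : Type*) [Field k] [PoissonRing V]
    [DiffPoissonAlgebra k V] : GDAlgebra k V where
  circ := DiffPoissonAlgebra.circ k
  left_symm a b c := by
    simp only [circ_apply, der_mul', mul_add]
    rw [← mul_assoc a, ← mul_assoc b, ← mul_assoc a, ← mul_assoc b, mul_comm b a]
    abel
  right_comm a b c := by
    simp only [circ_apply]
    rw [mul_assoc, mul_comm (der (k := k) b), ← mul_assoc]
  compat a b c := by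
    simp only [circ_apply, der_lie', PoissonRing.lie_mul', mul_add]
    rw [← lie_skew a b, ← lie_skew c b, ← lie_skew (der (k := k) a) c, neg_mul, neg_mul, mul_neg]
    abel

/-- A map of GD-algebras: a linear map that preserves both operations. -/
def IsGDHom {k A B : Type*} [Field k] [LieRing A] [GDAlgebra k A] [LieRing B] [GDAlgebra k B]
    (φ : A →ₗ⁅k⁆ B) : Prop :=
  ∀ a b : A, φ (GDAlgebra.circ (k := k) a b) = GDAlgebra.circ (k := k) (φ a) (φ b)

/-- A GD-algebra is special if it embeds into a differential Poisson algebra with the operations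
`⁅u, v⁆` and `u ∘ v = u d(v)`. -/
def IsSpecialGD.{p, q, r} (k : Type q) (A : Type r) [Field k] [LieRing A] [GDAlgebra k A] : Prop :=
  ∃ (V : Type p) (_ : PoissonRing V) (_ : DiffPoissonAlgebra k V) (φ : A →ₗ⁅k⁆ V),
    IsGDHom φ ∧ Function.Injective φ

/-- The class `SGD`: all homomorphic images of special GD-algebras. -/
def InSGD.{p, q, r} (k : Type q) (A : Type r) [Field k] [LieRing A] [GDAlgebra k A] : Prop :=
  ∃ (B : Type p) (_ : LieRing B) (_ : GDAlgebra k B), IsSpecialGD.{p} k B ∧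
    ∃ φ : B →ₗ⁅k⁆ A, IsGDHom φ ∧ Function.Surjective φ

/-- A subalgebra of a GD-algebra: a Lie subalgebra closed under `∘`. -/
structure GDSubalgebra (k A : Type*) [Field k] [LieRing A] [GDAlgebra k A] extends
    LieSubalgebra k A where
  circ_mem' : ∀ {a b : A}, a ∈ carrier → b ∈ carrier → GDAlgebra.circ (k := k) a b ∈ carrier

namespace GDSubalgebra

variable {k A : Type*} [Field k] [LieRing A] [GDAlgebra k A]

/-- A subalgebra of a GD-algebra is a GD-algebra under the restricted operations. -/
instance (S : GDSubalgebra k A) : GDAlgebra k S.toLieSubalgebra where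
  circ := LinearMap.mk₂ k
    (fun a b => (⟨GDAlgebra.circ (k := k) (a : A) (b : A), S.circ_mem' a.2 b.2⟩ :
      S.toLieSubalgebra))
    (fun _ _ _ => Subtype.ext (by simp))
    (fun _ _ _ => Subtype.ext (by simp))
    (fun _ _ _ => Subtype.ext (by simp))
    (fun _ _ _ => Subtype.ext (by simp))
  left_symm a b c := Subtype.ext (GDAlgebra.left_symm (a : A) b c)
  right_comm a b c := Subtype.ext (GDAlgebra.right_comm (a : A) b c)
  compat a b c := Subtype.ext (GDAlgebra.compat (a : A) b c)

/-- The subalgebra of a GD-algebra generated by a set: the intersection of all subalgebras that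
contain it. -/
def closure (s : Set A) : GDSubalgebra k A where
  carrier := {a | ∀ S : GDSubalgebra k A, s ⊆ (S.toLieSubalgebra : Set A) → a ∈ S.toLieSubalgebra}
  zero_mem' S _ := S.toLieSubalgebra.zero_mem
  add_mem' ha hb S h := S.toLieSubalgebra.add_mem (ha S h) (hb S h)
  smul_mem' c _ ha S h := S.toLieSubalgebra.smul_mem c (ha S h)
  lie_mem' ha hb S h := S.toLieSubalgebra.lie_mem (ha S h) (hb S h)
  circ_mem' ha hb S h := S.circ_mem' (ha S h) (hb S h)

theorem subset_closure (s : Set A) : s ⊆ ((closure s : GDSubalgebra k A).toLieSubalgebra : Set A) :=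
  fun _ ha _ h => h ha

end GDSubalgebra

/-! ### The free differential Poisson algebra -/

/-- Formal differential Poisson monomials in the variables `X`. -/
inductive DPMonomial (X : Type*) : Type _
  | var (x : X) : DPMonomial X
  | der (u : DPMonomial X) : DPMonomial X
  | lie (u v : DPMonomial X) : DPMonomial X
  | mul (u v : DPMonomial X) : DPMonomial X

/-- The weight: `wt x = -1`, `wt (d u) = wt u + 1`, `wt {u, v} = wt u + wt v + 1`,
`wt (u v) = wt u + wt v`. -/
def DPMonomial.wt {X : Type*} : DPMonomial X → ℤ
  | .var _ => -1
  | .der u => u.wt + 1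
  | .lie u v => u.wt + v.wt + 1
  | .mul u v => u.wt + v.wt

/-- The value of a formal monomial in a differential Poisson algebra under a substitution. -/
def DPMonomial.eval (k : Type*) {X V : Type*} [Field k] [PoissonRing V] [DiffPoissonAlgebra k V]
    (f : X → V) : DPMonomial X → V
  | .var x => f x
  | .der u => DiffPoissonAlgebra.der (k := k) (u.eval k f)
  | .lie u v => ⁅u.eval k f, v.eval k f⁆
  | .mul u v => u.eval k f * v.eval k f

namespace FreePoisDer

noncomputable section

variable (k X : Type*) [Field k]

/-- The absolutely free algebra with two bilinear operations and one linear operation. -/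
abbrev Pre : Type _ := DPMonomial X →₀ k

/-- The bilinear extension of a binary operation on formal monomials. -/
def bilin (op : DPMonomial X → DPMonomial X → DPMonomial X) : Pre k X →ₗ[k] Pre k X →ₗ[k] Pre k X :=
  Finsupp.linearCombination k fun u => Finsupp.linearCombination k fun v => Finsupp.single (op u v) 1

/-- The formal commutative product. -/
def preMul : Pre k X →ₗ[k] Pre k X →ₗ[k] Pre k X := bilin k X .mul

/-- The formal bracket. -/
def preLie : Pre k X →ₗ[k] Pre k X →ₗ[k] Pre k X := bilin k X .lie

/-- The formal derivation. -/
def preDer : Pre k X →ₗ[k] Pre k X :=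
  Finsupp.linearCombination k fun u => Finsupp.single (DPMonomial.der u) 1

/-- The submodule of relations: the smallest one that is closed under the operations and contains
all values of the defining identities of differential Poisson algebras. -/
inductive Rel : Pre k X → Prop
  | zero : Rel 0
  | add {a b} : Rel a → Rel b → Rel (a + b)
  | smul (c : k) {a} : Rel a → Rel (c • a)
  | mul_left (a) {b} : Rel b → Rel (preMul k X a b)
  | mul_right {a} (b) : Rel a → Rel (preMul k X a b)
  | lie_left (a) {b} : Rel b → Rel (preLie k X a b)
  | lie_right {a} (b) : Rel a → Rel (preLie k X a b)
  | der {a} : Rel a → Rel (preDer k X a)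
  | mul_comm (a b) : Rel (preMul k X a b - preMul k X b a)
  | mul_assoc (a b c) :
      Rel (preMul k X (preMul k X a b) c - preMul k X a (preMul k X b c))
  | lie_self (a) : Rel (preLie k X a a)
  | jacobi (a b c) :
      Rel (preLie k X a (preLie k X b c)
        - (preLie k X (preLie k X a b) c + preLie k X b (preLie k X a c)))
  | lie_mul (a b c) :
      Rel (preLie k X a (preMul k X b c)
        - (preMul k X (preLie k X a b) c + preMul k X b (preLie k X a c)))
  | der_mul (a b) :
      Rel (preDer k X (preMul k X a b)
        - (preMul k X (preDer k X a) b + preMul k X a (preDer k X b)))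
  | der_lie (a b) :
      Rel (preDer k X (preLie k X a b)
        - (preLie k X (preDer k X a) b + preLie k X a (preDer k X b)))

/-- `Rel` as a submodule. -/
def relSubmodule : Submodule k (Pre k X) where
  carrier := {a | Rel k X a}
  zero_mem' := .zero
  add_mem' := .add
  smul_mem' c _ := .smul c

end

end FreePoisDer

/-- The free differential Poisson algebra over `k` generated by `X`. -/
def PoisDer (k X : Type*) [Field k] : Type _ :=
  FreePoisDer.Pre k X ⧸ FreePoisDer.relSubmodule k X

namespace PoisDer

open FreePoisDer

noncomputable section

variable (k X : Type*) [Field k]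

instance : AddCommGroup (PoisDer k X) :=
  inferInstanceAs (AddCommGroup (Pre k X ⧸ relSubmodule k X))

instance : Module k (PoisDer k X) :=
  inferInstanceAs (Module k (Pre k X ⧸ relSubmodule k X))

/-- The quotient map. -/
def mk : Pre k X →ₗ[k] PoisDer k X := (relSubmodule k X).mkQ

variable {k X}

theorem mk_surjective : Function.Surjective (mk k X) := Submodule.mkQ_surjective _

theorem mk_eq_zero {a : Pre k X} (h : Rel k X a) : mk k X a = 0 :=
  (Submodule.Quotient.mk_eq_zero _).2 h

theorem mk_eq {a b : Pre k X} (h : Rel k X (a - b)) : mk k X a = mk k X b :=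
  (Submodule.Quotient.eq _).2 h

/-- A bilinear operation that respects the relations descends to the quotient. -/
def descend (B : Pre k X →ₗ[k] Pre k X →ₗ[k] Pre k X)
    (h₁ : ∀ a b, Rel k X a → Rel k X (B a b)) (h₂ : ∀ a b, Rel k X b → Rel k X (B a b)) :
    PoisDer k X →ₗ[k] PoisDer k X →ₗ[k] PoisDer k X :=
  (relSubmodule k X).liftQ
    (((relSubmodule k X).liftQ (B.compr₂ (mk k X)).flip fun b hb =>
      LinearMap.ext fun a => mk_eq_zero (h₂ a b hb)).flip)
    fun a ha => LinearMap.ext fun y => by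
      obtain ⟨b, rfl⟩ := mk_surjective y
      exact mk_eq_zero (h₁ a b ha)

/-- The commutative product of the free differential Poisson algebra. -/
def mulQ : PoisDer k X →ₗ[k] PoisDer k X →ₗ[k] PoisDer k X :=
  descend (preMul k X) (fun _ b h => .mul_right b h) (fun a _ h => .mul_left a h)

/-- The bracket of the free differential Poisson algebra. -/
def lieQ : PoisDer k X →ₗ[k] PoisDer k X →ₗ[k] PoisDer k X :=
  descend (preLie k X) (fun _ b h => .lie_right b h) (fun a _ h => .lie_left a h)

/-- The derivation of the free differential Poisson algebra. -/
def derQ : PoisDer k X →ₗ[k] PoisDer k X :=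
  (relSubmodule k X).mapQ (relSubmodule k X) (preDer k X) fun _ h => Rel.der h

theorem mulQ_mk (a b : Pre k X) : mulQ (mk k X a) (mk k X b) = mk k X (preMul k X a b) := rfl

theorem lieQ_mk (a b : Pre k X) : lieQ (mk k X a) (mk k X b) = mk k X (preLie k X a b) := rfl

theorem derQ_mk (a : Pre k X) : derQ (mk k X a) = mk k X (preDer k X a) := rfl

instance : PoissonRing (PoisDer k X) where
  mul a b := mulQ a b
  bracket a b := lieQ a b
  left_distrib a b c := map_add (mulQ a) b c
  right_distrib a b c := LinearMap.map_add₂ mulQ a b c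
  zero_mul a := LinearMap.map_zero₂ mulQ a
  mul_zero a := map_zero (mulQ a)
  mul_assoc x y z := by
    obtain ⟨a, rfl⟩ := mk_surjective x
    obtain ⟨b, rfl⟩ := mk_surjective y
    obtain ⟨c, rfl⟩ := mk_surjective z
    exact mk_eq (.mul_assoc a b c)
  mul_comm x y := by
    obtain ⟨a, rfl⟩ := mk_surjective x
    obtain ⟨b, rfl⟩ := mk_surjective y
    exact mk_eq (.mul_comm a b)
  add_lie a b c := LinearMap.map_add₂ lieQ a b c
  lie_add a b c := map_add (lieQ a) b c
  lie_self x := by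
    obtain ⟨a, rfl⟩ := mk_surjective x
    exact mk_eq_zero (.lie_self a)
  leibniz_lie x y z := by
    obtain ⟨a, rfl⟩ := mk_surjective x
    obtain ⟨b, rfl⟩ := mk_surjective y
    obtain ⟨c, rfl⟩ := mk_surjective z
    exact mk_eq (.jacobi a b c)
  lie_mul' x y z := by
    obtain ⟨a, rfl⟩ := mk_surjective x
    obtain ⟨b, rfl⟩ := mk_surjective y
    obtain ⟨c, rfl⟩ := mk_surjective z
    exact mk_eq (.lie_mul a b c)

instance : DiffPoissonAlgebra k (PoisDer k X) where
  lie_smul c a b := map_smul (lieQ a) c b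
  smul_mul' c a b := LinearMap.map_smul₂ mulQ c a b
  der := derQ
  der_mul' x y := by
    obtain ⟨a, rfl⟩ := mk_surjective x
    obtain ⟨b, rfl⟩ := mk_surjective y
    exact mk_eq (.der_mul a b)
  der_lie' x y := by
    obtain ⟨a, rfl⟩ := mk_surjective x
    obtain ⟨b, rfl⟩ := mk_surjective y
    exact mk_eq (.der_lie a b)

variable (k)

/-- The generator of the free differential Poisson algebra that belongs to `x`. -/
def of (x : X) : PoisDer k X := mk k X (Finsupp.single (.var x) 1)

end

end PoisDer

/-! ### The free special GD-algebra -/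

/-- The subalgebra of `PoisDer k X` generated by `X` under the bracket and `u ∘ v = u d(v)`. -/
noncomputable def SGD (k X : Type*) [Field k] : GDSubalgebra k (PoisDer k X) :=
  GDSubalgebra.closure (Set.range (PoisDer.of k))

/-- The generators, as elements of `SGD k X`. -/
noncomputable def SGD.of (k : Type*) {X : Type*} [Field k] (x : X) : (SGD k X).toLieSubalgebra :=
  ⟨PoisDer.of k x, GDSubalgebra.subset_closure _ ⟨x, rfl⟩⟩

namespace GDSubalgebra

theorem closure_induction {k A : Type*} [Field k] [LieRing A] [GDAlgebra k A] {s : Set A}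
    {p : ∀ a : A, a ∈ (closure s : GDSubalgebra k A).toLieSubalgebra → Prop}
    (mem : ∀ a (h : a ∈ s), p a (subset_closure s h))
    (zero : p 0 (zero_mem _))
    (add : ∀ a b ha hb, p a ha → p b hb → p (a + b) (add_mem ha hb))
    (smul : ∀ (c : k) a ha, p a ha → p (c • a) (Submodule.smul_mem _ c ha))
    (lie : ∀ a b ha hb, p a ha → p b hb → p ⁅a, b⁆ (LieSubalgebra.lie_mem _ ha hb))
    (circ : ∀ a b ha hb, p a ha → p b hb →
      p (GDAlgebra.circ (k := k) a b) ((closure s : GDSubalgebra k A).circ_mem' ha hb))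
    {a : A} (ha : a ∈ (closure s : GDSubalgebra k A).toLieSubalgebra) : p a ha := by
  let S : GDSubalgebra k A :=
    { carrier := {a | ∃ h, p a h}
      zero_mem' := ⟨_, zero⟩
      add_mem' := fun ⟨_, h₁⟩ ⟨_, h₂⟩ => ⟨_, add _ _ _ _ h₁ h₂⟩
      smul_mem' := fun c _ ⟨_, h⟩ => ⟨_, smul c _ _ h⟩
      lie_mem' := fun ⟨_, h₁⟩ ⟨_, h₂⟩ => ⟨_, lie _ _ _ _ h₁ h₂⟩
      circ_mem' := fun ⟨_, h₁⟩ ⟨_, h₂⟩ => ⟨_, circ _ _ _ _ h₁ h₂⟩ }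
  obtain ⟨_, h⟩ := ha S fun a h => ⟨_, mem a h⟩
  exact h

/-- The inclusion of a subalgebra preserves both operations. -/
theorem isGDHom_incl {k A : Type*} [Field k] [LieRing A] [GDAlgebra k A] (S : GDSubalgebra k A) :
    IsGDHom S.toLieSubalgebra.incl :=
  fun _ _ => rfl

section Filtration

open DiffPoissonAlgebra

variable {k V : Type*} [Field k] [PoissonRing V] [DiffPoissonAlgebra k V] (S : GDSubalgebra k V)

/-- The elements of a differential Poisson algebra that are multiplied into `S` by every product of
`n` elements of `S`. -/
def multipliers : ℕ → Submodule k V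
  | 0 => S.toLieSubalgebra.toSubmodule
  | n + 1 =>
    { carrier := {v | ∀ a ∈ S.toLieSubalgebra, a * v ∈ multipliers n}
      zero_mem' := fun a _ => by rw [mul_zero]; exact zero_mem _
      add_mem' := fun hu hv a ha => by rw [mul_add]; exact add_mem (hu a ha) (hv a ha)
      smul_mem' := fun c v hv a ha => by
        rw [mul_smul']; exact Submodule.smul_mem _ c (hv a ha) }

variable {S}

theorem mem_multipliers_zero {v : V} : v ∈ S.multipliers 0 ↔ v ∈ S.toLieSubalgebra := Iff.rfl

theorem mem_multipliers_succ {n : ℕ} {v : V} :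
    v ∈ S.multipliers (n + 1) ↔ ∀ a ∈ S.toLieSubalgebra, a * v ∈ S.multipliers n := Iff.rfl

theorem mul_der_mem {a b : V} (ha : a ∈ S.toLieSubalgebra) (hb : b ∈ S.toLieSubalgebra) :
    a * der (k := k) b ∈ S.toLieSubalgebra :=
  S.circ_mem' ha hb

theorem mul_mem_multipliers {m n : ℕ} {u v : V} (hu : u ∈ S.multipliers m)
    (hv : v ∈ S.multipliers (n + 1)) : u * v ∈ S.multipliers (m + n) := by
  induction m generalizing u with
  | zero => rw [Nat.zero_add]; exact hv u hu
  | succ m ih =>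
    rw [Nat.succ_add, mem_multipliers_succ]
    intro a ha
    rw [← mul_assoc]
    exact ih (hu a ha)

theorem der_mem_multipliers {n : ℕ} {v : V} (hv : v ∈ S.multipliers n) :
    der (k := k) v ∈ S.multipliers (n + 1) := by
  induction n generalizing v with
  | zero => exact fun a ha => mul_der_mem ha hv
  | succ n ih =>
    intro a ha b hb
    have h₁ := ih (hv a ha) b hb
    have h₂ := hv _ (mul_der_mem hb ha)
    rw [der_mul', mul_add, ← mul_assoc b _ v] at h₁
    exact (add_mem_cancel_left h₂).1 h₁

theorem lie_mem_multipliers_right {n : ℕ} {a v : V} (ha : a ∈ S.toLieSubalgebra)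
    (hv : v ∈ S.multipliers n) : ⁅a, v⁆ ∈ S.multipliers n := by
  induction n generalizing v with
  | zero => exact S.lie_mem' ha hv
  | succ n ih =>
    intro b hb
    have h₁ := ih (hv b hb)
    have h₂ := hv _ (S.lie_mem' ha hb)
    rw [PoissonRing.lie_mul'] at h₁
    exact (add_mem_cancel_left h₂).1 h₁

theorem _root_.PoissonRing.mul_lie {V : Type*} [PoissonRing V] (x y z : V) :
    ⁅x * y, z⁆ = ⁅x, z⁆ * y + x * ⁅y, z⁆ := by
  rw [← lie_skew, PoissonRing.lie_mul', ← lie_skew x z, ← lie_skew y z, neg_mul, mul_neg, neg_add]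

theorem lie_mem_multipliers {m n : ℕ} {u v : V} (hu : u ∈ S.multipliers m)
    (hv : v ∈ S.multipliers n) : ⁅u, v⁆ ∈ S.multipliers (m + n) := by
  induction m generalizing u with
  | zero => rw [Nat.zero_add]; exact lie_mem_multipliers_right hu hv
  | succ m ih =>
    rw [Nat.succ_add, mem_multipliers_succ]
    intro a ha
    have h₁ := ih (hu a ha)
    have h₂ := mul_mem_multipliers (lie_mem_multipliers_right ha hv) hu
    rw [PoissonRing.mul_lie] at h₁
    rw [Nat.add_comm n m] at h₂
    exact (add_mem_cancel_left h₂).1 h₁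

variable (S) in
/-- Sums of products `u₁ ⋯ uᵣ` of elements `uᵢ` of `S.multipliers nᵢ` with `∑ (nᵢ - 1) = w`. -/
inductive HasWeight : ℤ → V → Prop
  | of {n : ℕ} {w : ℤ} {u : V} (hu : u ∈ S.multipliers n) (hw : w = n - 1) : HasWeight w u
  | mul {n : ℕ} {w w' : ℤ} {u v : V} (hu : u ∈ S.multipliers n) (hv : HasWeight w v)
      (hw : w' = n - 1 + w) : HasWeight w' (u * v)
  | add {w : ℤ} {u v : V} (hu : HasWeight w u) (hv : HasWeight w v) : HasWeight w (u + v)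

theorem HasWeight.mul_hasWeight {w w' w'' : ℤ} {u v : V} (hu : S.HasWeight w u)
    (hv : S.HasWeight w' v) (hw : w'' = w + w') : S.HasWeight w'' (u * v) := by
  induction hu generalizing w'' with
  | of h e => exact .mul h hv (by omega)
  | mul h _ e ih => rw [mul_assoc]; exact .mul h (ih rfl) (by omega)
  | add _ _ ih₁ ih₂ => rw [add_mul]; exact .add (ih₁ hw) (ih₂ hw)

theorem HasWeight.der {w w' : ℤ} {u : V} (hu : S.HasWeight w u) (hw : w' = w + 1) :
    S.HasWeight w' (der (k := k) u) := by
  induction hu generalizing w' with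
  | of h e => exact .of (der_mem_multipliers h) (by push_cast; omega)
  | mul h hv e ih =>
    rw [der_mul']
    exact .add (.mul (der_mem_multipliers h) hv (by push_cast; omega)) (.mul h (ih rfl) (by omega))
  | add _ _ ih₁ ih₂ => rw [map_add]; exact .add (ih₁ hw) (ih₂ hw)

theorem HasWeight.lie_of_mem {n : ℕ} {w w' : ℤ} {u v : V} (hu : u ∈ S.multipliers n)
    (hv : S.HasWeight w v) (hw : w' = n + w) : S.HasWeight w' ⁅u, v⁆ := by
  induction hv generalizing w' with
  | of h e => exact .of (lie_mem_multipliers hu h) (by push_cast; omega)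
  | mul h hv e ih =>
    rw [PoissonRing.lie_mul']
    exact .add (.mul (lie_mem_multipliers hu h) hv (by push_cast; omega))
      (.mul h (ih rfl) (by omega))
  | add _ _ ih₁ ih₂ => rw [lie_add]; exact .add (ih₁ hw) (ih₂ hw)

theorem HasWeight.lie {w w' w'' : ℤ} {u v : V} (hu : S.HasWeight w u)
    (hv : S.HasWeight w' v) (hw : w'' = w + w' + 1) : S.HasWeight w'' ⁅u, v⁆ := by
  induction hu generalizing w'' with
  | of h e => exact .lie_of_mem h hv (by omega)
  | mul h hu e ih =>
    rw [PoissonRing.mul_lie]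
    exact .add ((HasWeight.lie_of_mem h hv rfl).mul_hasWeight hu (by omega))
      (.mul h (ih rfl) (by omega))
  | add _ _ ih₁ ih₂ => rw [add_lie]; exact .add (ih₁ hw) (ih₂ hw)

theorem mul_mem_multipliers' {m n l : ℕ} {u v : V} (hu : u ∈ S.multipliers m)
    (hv : v ∈ S.multipliers n) (h : l + 1 = m + n) : u * v ∈ S.multipliers l := by
  rcases n with _ | n
  · obtain rfl : m = l + 1 := by omega
    rw [mul_comm]
    exact hu v hv
  · obtain rfl : l = m + n := by omega
    exact mul_mem_multipliers hu hv

theorem HasWeight.mul_mem_multipliers {m n : ℕ} {w : ℤ} {u v : V} (hv : S.HasWeight w v)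
    (hu : u ∈ S.multipliers m) (h : (n : ℤ) = m + w) : u * v ∈ S.multipliers n := by
  induction hv generalizing m n u with
  | of hv e => exact mul_mem_multipliers' hu hv (by omega)
  | @mul l w _ u₁ v₁ hu₁ hv e ih =>
    by_cases hl : m + l = 0
    · obtain ⟨rfl, rfl⟩ : m = 0 ∧ l = 0 := by omega
      exact ih hu₁ (n := n + 1) (by push_cast; omega) u hu
    · rw [← mul_assoc]
      exact ih (mul_mem_multipliers' hu hu₁ (l := m + l - 1) (by omega)) (by omega)
  | add _ _ ih₁ ih₂ => rw [mul_add]; exact add_mem (ih₁ hu h) (ih₂ hu h)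

theorem HasWeight.mem {w : ℤ} {v : V} (hv : S.HasWeight w v) (hw : w = -1) :
    v ∈ S.toLieSubalgebra := by
  induction hv with
  | @of n _ _ h e =>
    obtain rfl : n = 0 := by omega
    exact h
  | mul h hv e => exact mem_multipliers_zero.1 (hv.mul_mem_multipliers h (by push_cast; omega))
  | add _ _ ih₁ ih₂ => exact add_mem (ih₁ hw) (ih₂ hw)

theorem hasWeight_eval {X : Type*} {f : X → V} (hf : ∀ x, f x ∈ S.toLieSubalgebra)
    (u : DPMonomial X) : S.HasWeight u.wt (u.eval k f) := by
  induction u with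
  | var x => exact .of (n := 0) (hf x) (by simp [DPMonomial.wt])
  | der u ih => exact ih.der rfl
  | lie u v ihu ihv => exact ihu.lie ihv rfl
  | mul u v ihu ihv => exact ihu.mul_hasWeight ihv rfl

end Filtration

end GDSubalgebra

/-- The values of the monomials of weight `-1` span a subalgebra with respect to the bracket and
`u ∘ v = u d(v)`. -/
def weightSubalgebra (k : Type*) {X V : Type*} [Field k] [PoissonRing V] [DiffPoissonAlgebra k V]
    (f : X → V) : GDSubalgebra k V where
  __ := Submodule.span k {a | ∃ u : DPMonomial X, u.wt = -1 ∧ u.eval k f = a}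
  lie_mem' {a b} ha hb := by
    induction ha, hb using Submodule.span_induction₂ with
    | mem_mem a b ha hb =>
      obtain ⟨u, hu, rfl⟩ := ha
      obtain ⟨v, hv, rfl⟩ := hb
      exact Submodule.subset_span ⟨.lie u v, by simp [DPMonomial.wt, hu, hv], rfl⟩
    | zero_left b hb => rw [zero_lie]; exact Submodule.zero_mem _
    | zero_right a ha => rw [lie_zero]; exact Submodule.zero_mem _
    | add_left a b c _ _ _ h₁ h₂ => rw [add_lie]; exact Submodule.add_mem _ h₁ h₂
    | add_right a b c _ _ _ h₁ h₂ => rw [lie_add]; exact Submodule.add_mem _ h₁ h₂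
    | smul_left c a b _ _ h => rw [smul_lie]; exact Submodule.smul_mem _ c h
    | smul_right c a b _ _ h => rw [lie_smul]; exact Submodule.smul_mem _ c h
  circ_mem' {a b} ha hb := by
    induction ha, hb using Submodule.span_induction₂ with
    | mem_mem a b ha hb =>
      obtain ⟨u, hu, rfl⟩ := ha
      obtain ⟨v, hv, rfl⟩ := hb
      exact Submodule.subset_span ⟨.mul u (.der v), by simp [DPMonomial.wt, hu, hv], rfl⟩
    | zero_left b hb => rw [LinearMap.map_zero₂]; exact Submodule.zero_mem _
    | zero_right a ha => rw [map_zero]; exact Submodule.zero_mem _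
    | add_left a b c _ _ _ h₁ h₂ => rw [LinearMap.map_add₂]; exact Submodule.add_mem _ h₁ h₂
    | add_right a b c _ _ _ h₁ h₂ => rw [map_add]; exact Submodule.add_mem _ h₁ h₂
    | smul_left c a b _ _ h => rw [LinearMap.map_smul₂]; exact Submodule.smul_mem _ c h
    | smul_right c a b _ _ h => rw [map_smul]; exact Submodule.smul_mem _ c h

theorem SGD_toSubmodule_eq_span (k X : Type*) [Field k] :
    (SGD k X).toLieSubalgebra.toSubmodule =
      Submodule.span k {a | ∃ u : DPMonomial X, u.wt = -1 ∧ u.eval k (PoisDer.of k) = a} := by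
  apply le_antisymm
  · intro a ha
    refine ha (weightSubalgebra k (PoisDer.of k)) ?_
    rintro _ ⟨x, rfl⟩
    exact Submodule.subset_span ⟨.var x, rfl, rfl⟩
  · rw [Submodule.span_le]
    rintro _ ⟨u, hu, rfl⟩
    exact (GDSubalgebra.hasWeight_eval (fun x => (SGD.of k x).2) u).mem hu

namespace PoisDer

open FreePoisDer DiffPoissonAlgebra

noncomputable section

variable {k X V : Type*} [Field k] [PoissonRing V] [DiffPoissonAlgebra k V] (f : X → V)

/-- The linear extension of the evaluation of formal monomials. -/
def preLift : Pre k X →ₗ[k] V := Finsupp.linearCombination k (DPMonomial.eval k f)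

theorem preLift_single (u : DPMonomial X) (c : k) :
    preLift f (Finsupp.single u c) = c • u.eval k f :=
  Finsupp.linearCombination_single ..

theorem bilin_single (op : DPMonomial X → DPMonomial X → DPMonomial X) (u v : DPMonomial X)
    (c e : k) : bilin k X op (Finsupp.single u c) (Finsupp.single v e) =
      c • e • Finsupp.single (op u v) 1 := by
  simp [bilin, Finsupp.linearCombination_single]

theorem preLift_preMul (a b : Pre k X) :
    preLift f (preMul k X a b) = preLift f a * preLift f b := by
  induction a using Finsupp.induction_linear with
  | zero => simp
  | add a a' h h' => simp only [map_add, LinearMap.add_apply, h, h', add_mul]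
  | single u c =>
    induction b using Finsupp.induction_linear with
    | zero => simp
    | add a a' h h' => simp only [map_add, h, h', mul_add]
    | single v e =>
      rw [preMul, bilin_single, map_smul, map_smul, preLift_single, preLift_single, preLift_single,
        PoissonAlgebra.smul_mul', mul_smul', one_smul]
      rfl

theorem preLift_preLie (a b : Pre k X) :
    preLift f (preLie k X a b) = ⁅preLift f a, preLift f b⁆ := by
  induction a using Finsupp.induction_linear with
  | zero => simp
  | add a a' h h' => simp only [map_add, LinearMap.add_apply, h, h', add_lie]
  | single u c =>
    induction b using Finsupp.induction_linear with
    | zero => simp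
    | add a a' h h' => simp only [map_add, h, h', lie_add]
    | single v e =>
      rw [preLie, bilin_single, map_smul, map_smul, preLift_single, preLift_single, preLift_single,
        smul_lie, lie_smul, one_smul]
      rfl

theorem preLift_preDer (a : Pre k X) :
    preLift f (preDer k X a) = der (k := k) (preLift f a) := by
  induction a using Finsupp.induction_linear with
  | zero => simp
  | add a a' h h' => simp only [map_add, h, h']
  | single u c =>
    rw [preDer, Finsupp.linearCombination_single, map_smul, preLift_single, preLift_single,
      map_smul, one_smul]
    rfl

theorem preLift_rel {a : Pre k X} (h : Rel k X a) : preLift f a = 0 := by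
  induction h with
  | zero => exact map_zero _
  | add _ _ h₁ h₂ => rw [map_add, h₁, h₂, add_zero]
  | smul c _ h => rw [map_smul, h, smul_zero]
  | mul_left a _ h => rw [preLift_preMul, h, mul_zero]
  | mul_right b _ h => rw [preLift_preMul, h, zero_mul]
  | lie_left a _ h => rw [preLift_preLie, h, lie_zero]
  | lie_right b _ h => rw [preLift_preLie, h, zero_lie]
  | der _ h => rw [preLift_preDer, h, map_zero]
  | mul_comm a b => rw [map_sub, preLift_preMul, preLift_preMul, _root_.mul_comm, sub_self]
  | mul_assoc a b c => simp only [map_sub, preLift_preMul, _root_.mul_assoc, sub_self]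
  | lie_self a => rw [preLift_preLie, _root_.lie_self]
  | jacobi a b c =>
    simp only [map_sub, map_add, preLift_preLie]
    rw [leibniz_lie, sub_self]
  | lie_mul a b c =>
    simp only [map_sub, map_add, preLift_preLie, preLift_preMul]
    rw [PoissonRing.lie_mul', sub_self]
  | der_mul a b =>
    simp only [map_sub, map_add, preLift_preDer, preLift_preMul]
    rw [der_mul', sub_self]
  | der_lie a b =>
    simp only [map_sub, map_add, preLift_preDer, preLift_preLie]
    rw [der_lie', sub_self]

/-- The linear map from the free differential Poisson algebra that extends `f`. -/
def lift : PoisDer k X →ₗ[k] V :=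
  (relSubmodule k X).liftQ (preLift f) fun _ h => preLift_rel f h

theorem lift_mk (a : Pre k X) : lift f (mk k X a) = preLift f a := rfl

theorem lift_of (x : X) : lift f (of k x) = f x := by
  rw [of, lift_mk, preLift_single, one_smul]
  rfl

theorem lift_lie (a b : PoisDer k X) : lift f ⁅a, b⁆ = ⁅lift f a, lift f b⁆ := by
  obtain ⟨a, rfl⟩ := mk_surjective a
  obtain ⟨b, rfl⟩ := mk_surjective b
  exact preLift_preLie f a b

theorem lift_mul (a b : PoisDer k X) : lift f (a * b) = lift f a * lift f b := by
  obtain ⟨a, rfl⟩ := mk_surjective a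
  obtain ⟨b, rfl⟩ := mk_surjective b
  exact preLift_preMul f a b

theorem lift_der (a : PoisDer k X) : lift f (der (k := k) a) = der (k := k) (lift f a) := by
  obtain ⟨a, rfl⟩ := mk_surjective a
  exact preLift_preDer f a

theorem lift_circ (a b : PoisDer k X) : lift f (GDAlgebra.circ (k := k) a b) =
    GDAlgebra.circ (k := k) (lift f a) (lift f b) :=
  (lift_mul f a _).trans (congrArg _ (lift_der f b))

end

end PoisDer

namespace SGD

variable {k X : Type*} [Field k]

theorem isSpecialGD_coe (k : Type u) [Field k] (X : Type v) :
    IsSpecialGD.{max u v} k (SGD k X).toLieSubalgebra :=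
  ⟨PoisDer k X, inferInstance, inferInstance, (SGD k X).toLieSubalgebra.incl,
    (SGD k X).isGDHom_incl, Subtype.val_injective⟩

/-- A special GD-algebra is in the class `SGD`. -/
theorem _root_.IsSpecialGD.inSGD {k : Type u} {A : Type v} [Field k] [LieRing A] [GDAlgebra k A]
    (h : IsSpecialGD.{v} k A) : InSGD.{v} k A :=
  ⟨A, inferInstance, inferInstance, h, LieHom.id, fun _ _ => rfl, Function.surjective_id⟩

theorem hom_ext {A : Type*} [LieRing A] [GDAlgebra k A] {φ ψ : (SGD k X).toLieSubalgebra →ₗ⁅k⁆ A}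
    (hφ : IsGDHom φ) (hψ : IsGDHom ψ) (h : ∀ x, φ (of k x) = ψ (of k x)) : φ = ψ := by
  ext ⟨a, ha⟩
  refine GDSubalgebra.closure_induction (p := fun a ha => φ ⟨a, ha⟩ = ψ ⟨a, ha⟩)
    ?_ ?_ ?_ ?_ ?_ ?_ ha
  · rintro _ ⟨x, rfl⟩
    exact h x
  · exact (map_zero φ).trans (map_zero ψ).symm
  · intro a b ha hb h₁ h₂
    exact (map_add φ ⟨a, ha⟩ ⟨b, hb⟩).trans
      ((congrArg₂ (· + ·) h₁ h₂).trans (map_add ψ ⟨a, ha⟩ ⟨b, hb⟩).symm)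
  · intro c a ha h₁
    exact (map_smul φ c ⟨a, ha⟩).trans ((congrArg (c • ·) h₁).trans (map_smul ψ c ⟨a, ha⟩).symm)
  · intro a b ha hb h₁ h₂
    exact (φ.map_lie ⟨a, ha⟩ ⟨b, hb⟩).trans
      ((congrArg₂ (⁅·, ·⁆) h₁ h₂).trans (ψ.map_lie ⟨a, ha⟩ ⟨b, hb⟩).symm)
  · intro a b ha hb h₁ h₂
    exact (hφ ⟨a, ha⟩ ⟨b, hb⟩).trans
      ((congrArg₂ (fun x y => GDAlgebra.circ (k := k) x y) h₁ h₂).trans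
        (hψ ⟨a, ha⟩ ⟨b, hb⟩).symm)

theorem exists_hom_of_isSpecialGD.{p} {B : Type*} [LieRing B] [GDAlgebra k B]
    (hB : IsSpecialGD.{p} k B) (f : X → B) :
    ∃ φ : (SGD k X).toLieSubalgebra →ₗ⁅k⁆ B, IsGDHom φ ∧ ∀ x, φ (of k x) = f x := by
  obtain ⟨V, _, _, ι, hι, hinj⟩ := hB
  have key : ∀ a : (SGD k X).toLieSubalgebra,
      ∃ b, ι b = PoisDer.lift (k := k) (fun x => ι (f x)) (a : PoisDer k X) := by
    rintro ⟨a, ha⟩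
    refine GDSubalgebra.closure_induction
      (p := fun a _ => ∃ b, ι b = PoisDer.lift (k := k) (fun x => ι (f x)) a) ?_ ?_ ?_ ?_ ?_ ?_ ha
    · rintro _ ⟨x, rfl⟩
      exact ⟨f x, (PoisDer.lift_of (fun x => ι (f x)) x).symm⟩
    · exact ⟨0, by rw [map_zero, map_zero]⟩
    · rintro a b _ _ ⟨a', ha⟩ ⟨b', hb⟩
      exact ⟨a' + b', by rw [map_add, map_add, ha, hb]⟩
    · rintro c a _ ⟨a', ha⟩
      exact ⟨c • a', by rw [map_smul, map_smul, ha]⟩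
    · rintro a b _ _ ⟨a', ha⟩ ⟨b', hb⟩
      exact ⟨⁅a', b'⁆, by rw [LieHom.map_lie, PoisDer.lift_lie, ha, hb]⟩
    · rintro a b _ _ ⟨a', ha⟩ ⟨b', hb⟩
      exact ⟨GDAlgebra.circ (k := k) a' b', by rw [hι, PoisDer.lift_circ, ha, hb]⟩
  choose g hg using key
  refine ⟨{ toFun := g, map_add' := fun a b => hinj ?_, map_smul' := fun c a => hinj ?_,
            map_lie' := fun {a b} => hinj ?_ }, fun a b => hinj ?_, fun x => hinj ?_⟩
  · rw [map_add, hg, hg, hg]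
    exact map_add _ _ _
  · rw [map_smul, hg, hg]
    exact map_smul _ _ _
  · rw [LieHom.map_lie, hg, hg, hg]
    exact PoisDer.lift_lie _ _ _
  · rw [hι]
    change ι (g _) = GDAlgebra.circ (k := k) (ι (g a)) (ι (g b))
    rw [hg, hg, hg]
    exact PoisDer.lift_circ _ _ _
  · exact (hg _).trans (PoisDer.lift_of _ x)

theorem exists_hom_of_inSGD.{p} {A : Type*} [LieRing A] [GDAlgebra k A] (hA : InSGD.{p} k A)
    (f : X → A) :
    ∃ φ : (SGD k X).toLieSubalgebra →ₗ⁅k⁆ A, IsGDHom φ ∧ ∀ x, φ (of k x) = f x := by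
  obtain ⟨B, _, _, hB, π, hπ, hsurj⟩ := hA
  choose s hs using hsurj
  obtain ⟨φ, hφ, hφf⟩ := exists_hom_of_isSpecialGD hB fun x => s (f x)
  refine ⟨π.comp φ, fun a b => ?_, fun x => ?_⟩
  · rw [LieHom.comp_apply, hφ, hπ]
    rfl
  · rw [LieHom.comp_apply, hφf, hs]

end SGD

theorem mainTheorem7 (k : Type u) [Field k] (X : Type v) :
    -- the subalgebra of `PoisDer k X` generated by `X` is the free algebra of the class `SGD`
    (InSGD.{max u v} k (SGD k X).toLieSubalgebra ∧
      ∀ (A : Type w) [LieRing A] [GDAlgebra k A], InSGD.{w'} k A → ∀ f : X → A,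
        ∃! φ : (SGD k X).toLieSubalgebra →ₗ⁅k⁆ A, IsGDHom φ ∧ ∀ x, φ (SGD.of k x) = f x) ∧
    -- it is spanned exactly by the differential Poisson monomials of weight `-1`
    (SGD k X).toLieSubalgebra.toSubmodule =
      Submodule.span k {a | ∃ u : DPMonomial X, u.wt = -1 ∧ u.eval k (PoisDer.of k) = a} := by
  refine ⟨⟨(SGD.isSpecialGD_coe k X).inSGD, fun A _ _ hA f => ?_⟩, SGD_toSubmodule_eq_span k X⟩
  obtain ⟨φ, hφ, hφf⟩ := SGD.exists_hom_of_inSGD hA f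
  exact ⟨φ, ⟨hφ, hφf⟩, fun ψ hψ => SGD.hom_ext hψ.1 hφ fun x => (hψ.2 x).trans (hφf x).symm⟩
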